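/- **Theorem 3.1.** Conventions. $\log x$ denotes the truncated logarithm $\ln(\max(x,e))$. Let $\mathcal X$ be a measurable space, $\mathcal Y=\{1,-1\}$, and let $\mathcal F$ be a set of measurable functions $\mathcal X\to\mathcal Y$. * The growth function $\mathcal S_{\mathcal F}(k)$ is the maximum, over $x_1,\dots,x_k\in\mathcal X$, of the number of vectors $(f(x_1),\dots,f(x_k))$, $f\in\mathcal F$. * The star number $\mathbf s\in\{0,1,2,\dots\}\cup\{\infty\}$ of $\mathcal F$ is the largest $k$ for which there are distinct $x_1,\dots,x_k\in\mathcal X$ and $f_0,f_1,\dots,f_k\in\mathcal F$ such that, for every $i\in\{1,\dots,k\}$, $x_i$ is the only point of $\{x_1,\dots,x_k\}$ at which $f_0$ and $f_i$ disagree ($\mathbf s=\infty$ if there are such configurations for arbitrarily large $k$). * For a probability measure $P$ on $\mathcal X\times\mathcal Y$, the risk of a classifier $f$ is $R(f)=P(f(X)\ne Y)$. The realizable case means that there is $f^*\in\mathcal F$ with $Y=f^*(X)$ $P$-almost surely. * An empirical risk minimizer (ERM) $\hat f$ on samples of size $n$ is a map that assigns to each sample $((X_1,Y_1),\dots,(X_n,Y_n))$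 a classifier in $\mathcal F$ that minimizes $\frac1n\sum_{i=1}^n \mathbf 1[f(X_i)\neq Y_i]$ over $f\in\mathcal F$. * Measurability is assumed: the random variable $R(\hat f)$ is measurable for the completed law of the sample, and for each $k$ and each $y\in\mathcal Y^k$ the event that some $f\in\mathcal F$ has $f(X_i)=y_i$ for all $i\le k$, where $X_1,\dots,X_k$ are i.i.d. from the marginal of $P$ on $\mathcal X$, is measurable for the completed law of $(X_1,\dots,X_k)$. There is a universal constant $C>0$ such that for all such $\mathcal X$ and $\mathcal F$, every $P$ in the realizable case, every $n\ge1$ and every ERM $\hat f$ on i.i.d. samples of size $n$ from $P$, $$\mathbb E\,R(\hat f)\;\le\; C\,\frac{\log\mathcal S_{\mathcal F}(\mathbf s\wedge n)}{n},$$ and, for every $\delta\in(0,1)$, with probability at least $1-\delta$, $$R(\hat f)\;\le\; C\left(\frac{\log\mathcal S_{\mathcal F}(\mathbf s\wedge n)}{n}+\frac{\log(1/\delta)}{n}\right).$$ -/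

import Mathlib

open MeasureTheory

universe u

namespace ERMStar

noncomputable section

/-- The label space `{1, -1}`, realised as the units of `ℤ`; its σ-algebra is discrete. -/
abbrev Label : Type := ℤˣ

instance : DiscreteMeasurableSpace Label where
  forall_measurableSet s :=
    ⟨Units.val '' s, MeasurableSet.of_discrete, Set.preimage_image_eq s Units.val_injective⟩

/-- The truncated logarithm `ln (max (x, e))`. -/
def tlog (x : ℝ) : ℝ := Real.log (max x (Real.exp 1))

variable {X : Type u}

/-- `DIS(B)`: the points on which two members of `B` disagree. -/
def DIS (B : Set (X → Label)) : Set X := {x | ∃ f ∈ B, ∃ g ∈ B, f x ≠ g x}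

/-- `F(x₁, …, x_k)`: the set of classifications of the points `x₁, …, x_k` realised by `F`. -/
def projection (F : Set (X → Label)) {k : ℕ} (x : Fin k → X) : Set (Fin k → Label) :=
  (fun f i => f (x i)) '' F

/-- The growth function: the maximal number of classifications of `k` points realised by `F`.
The supremum is over a set of natural numbers bounded by `2 ^ k`. -/
def growth (F : Set (X → Label)) (k : ℕ) : ℕ := ⨆ x : Fin k → X, (projection F x).ncard

/-- There are distinct points `x₁, …, x_k` and `f₀, f₁, …, f_k ∈ F` such that
`DIS {f₀, fᵢ} ∩ {x₁, …, x_k} = {xᵢ}` for each `i`. -/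
def HasStar (F : Set (X → Label)) (k : ℕ) : Prop :=
  ∃ x : Fin k → X, Function.Injective x ∧
    ∃ f₀ ∈ F, ∃ f : Fin k → X → Label, (∀ i, f i ∈ F) ∧
      ∀ i, DIS {f₀, f i} ∩ Set.range x = {x i}

/-- The star number: the largest `k` with a star of size `k`, and `⊤` if there are arbitrarily
large ones. -/
def starNumber (F : Set (X → Label)) : ℕ∞ := ⨆ (k : ℕ) (_ : HasStar F k), (k : ℕ∞)

/-- The empirical risk `R_n(f)`: the fraction of the sample that `f` misclassifies. -/
def empRisk {n : ℕ} (S : Fin n → X × Label) (f : X → Label) : ℝ :=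
  (∑ i, if f (S i).1 ≠ (S i).2 then (1 : ℝ) else 0) / n

/-- `A` is an empirical risk minimizer over `F` for samples of size `n`. -/
def IsERM {n : ℕ} (F : Set (X → Label)) (A : (Fin n → X × Label) → (X → Label)) : Prop :=
  ∀ S, A S ∈ F ∧ ∀ f ∈ F, empRisk S (A S) ≤ empRisk S f

variable [MeasurableSpace X]

/-- The risk `R(f) = P(f(X) ≠ Y)`. -/
def risk (P : Measure (X × Label)) (f : X → Label) : ℝ := P.real {z | f z.1 ≠ z.2}

/-- The realizable case: some classifier `f* ∈ F` has `Y = f*(X)` almost surely. -/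
def Realizable (P : Measure (X × Label)) (F : Set (X → Label)) : Prop :=
  ∃ f ∈ F, ∀ᵐ z ∂P, z.2 = f z.1

/-- The law of an i.i.d. sample of size `n` from `P`. -/
def sampleLaw (P : Measure (X × Label)) (n : ℕ) : Measure (Fin n → X × Label) :=
  Measure.pi fun _ => P

/-- Measurability of events: for i.i.d. points `X₁, …, X_k` with the marginal law of `P`, each
event "the labelling `y` of `X₁, …, X_k` is realised by `F`" is measurable (for the completed
law), that is, the random finite set `F(X₁, …, X_k)` is a random variable. -/
def MeasurableProjections (P : Measure (X × Label)) (F : Set (X → Label)) : Prop :=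
  ∀ (k : ℕ) (y : Fin k → Label),
    NullMeasurableSet {x : Fin k → X | y ∈ projection F x}
      (Measure.pi fun _ => P.map Prod.fst)

end

end ERMStar

open ERMStar

/-! Let `g ∈ F` be the true classifier and `m` the minimum of the star number and `n`. An ERM agrees
with `g` on the sample almost surely. If its risk exceeds `600 * (q + t) / n`, then with probability
at least `1/2` it errs at least `300 * (q + t)` times on an independent ghost sample. By
exchangeability it suffices to fix the `2 * n` points, draw a uniform `n`-subset `T`, and bound the
chance that some `f ∈ F` agrees with `g` on `T` but errs on `k` of the points
(`card_consistent_le`).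

A union bound over all labellings of `2 * n` points would cost the logarithm of `growth F (2 * n)`.
To pay only for `growth F m`, `T` is revealed in two stages. The first stage is a subset `T₁` of
about half of `T`. The region `avoidRegion` where classifiers agreeing with `g` on `T₁` can still
err has fewer than `32 * m + j` points outside an event of exponentially small probability. Given
this, every relevant error pattern lies in that region, so there are at most `growth F (32 * m + j)
≤ growth F m ^ 32 * 2 ^ j` of them, and the rest of `T` misses a fixed pattern of size at least `k`
with probability at most `(2/3) ^ k`.

The size of the region is controlled by comparing two evaluations of one exponential moment,
`removalWeight`. Removing points from a set, the removed point lies in the region avoiding what is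
left exactly when it is essential; essential points form a star centred at `g`, so at most `m` exist
and such removals are rare (`exp_le_removalWeight`). Read backwards as adding points, a region that
is still large at the end was large throughout, so new points often fall in it
(`sum_removalWeight_le`). Both can hold only with exponentially small probability. -/

namespace ERMStar

open Finset

/-! ### Random subsets and the region they leave uncovered. -/

section Combinatorics

variable {ι : Type*} [Fintype ι] [DecidableEq ι]

/-- The union of the members of `H` that avoid `T`. -/
def avoidRegion (H : Finset (Finset ι)) (T : Finset ι) : Finset ι :=
  univ.filter fun i => ∃ E ∈ H, Disjoint E T ∧ i ∈ E

theorem mem_avoidRegion {H : Finset (Finset ι)} {T : Finset ι} {i : ι} :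
    i ∈ avoidRegion H T ↔ ∃ E ∈ H, Disjoint E T ∧ i ∈ E := by
  simp [avoidRegion]

theorem avoidRegion_anti (H : Finset (Finset ι)) {T W : Finset ι} (h : T ⊆ W) :
    avoidRegion H W ⊆ avoidRegion H T := by
  intro i
  simp only [mem_avoidRegion]
  rintro ⟨E, hE, hd, hi⟩
  exact ⟨E, hE, hd.mono_right h, hi⟩

theorem disjoint_avoidRegion (H : Finset (Finset ι)) (T : Finset ι) :
    Disjoint (avoidRegion H T) T := by
  rw [Finset.disjoint_left]
  intro i
  simp only [mem_avoidRegion]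
  rintro ⟨E, hE, hd, hi⟩
  exact Finset.disjoint_left.1 hd hi

/-- The points of `W` that are the only point of `W` in some member of `H`. -/
def essential (H : Finset (Finset ι)) (W : Finset ι) : Finset ι :=
  W.filter fun i => i ∈ avoidRegion H (W.erase i)

/-- The mean, over uniformly random removal orders of `d` points of `W`, of `2 ^ (-q)`, where `q`
counts the removed points that lie in the region avoiding what is left. -/
noncomputable def removalWeight (H : Finset (Finset ι)) : ℕ → Finset ι → ℝ
  | 0, _ => 1
  | d + 1, W => (∑ i ∈ W, (if i ∈ avoidRegion H (W.erase i) then (1 / 2 : ℝ) else 1) *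
      removalWeight H d (W.erase i)) / W.card

theorem removalWeight_nonneg (H : Finset (Finset ι)) (d : ℕ) (W : Finset ι) :
    0 ≤ removalWeight H d W := by
  induction d generalizing W with
  | zero => simp [removalWeight]
  | succ d ih =>
    rw [removalWeight]
    refine div_nonneg (Finset.sum_nonneg fun i _ => mul_nonneg ?_ (ih _)) (by positivity)
    split_ifs <;> norm_num

theorem exp_neg_le_one_sub_half {x : ℝ} (h0 : 0 ≤ x) (h1 : x ≤ 1) :
    Real.exp (-x) ≤ 1 - x / 2 := by
  have h := Real.add_one_le_exp x
  have h2 : Real.exp (-x) ≤ 1 / (1 + x) := by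
    rw [Real.exp_neg, ← one_div]
    exact one_div_le_one_div_of_le (by linarith) (by linarith)
  refine h2.trans ?_
  rw [div_le_iff₀ (by linarith)]
  nlinarith

/-- A random point of `W` is essential with probability at most `m / W.card ≤ m / a`, so each of the
`d` removals costs on average a factor at least `exp (-m / a)`. -/
theorem exp_le_removalWeight (H : Finset (Finset ι)) {m n a : ℕ} (ha : 0 < a)
    (hstar : ∀ W : Finset ι, W.card ≤ n → (essential H W).card ≤ m)
    (d : ℕ) (hn : a + d ≤ n) (W : Finset ι) (hW : W.card = a + d) :
    Real.exp (-(m * d / a : ℝ)) ≤ removalWeight H d W := by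
  induction d generalizing W with
  | zero => simp [removalWeight]
  | succ d ih =>
    have hWpos : (0 : ℝ) < W.card := by rw [hW]; positivity
    have ha' : (0 : ℝ) < a := by positivity
    rw [removalWeight, le_div_iff₀ hWpos]
    have hstep : ∀ i ∈ W, (if i ∈ avoidRegion H (W.erase i) then (1 / 2 : ℝ) else 1) *
        Real.exp (-(m * d / a : ℝ)) ≤
        (if i ∈ avoidRegion H (W.erase i) then (1 / 2 : ℝ) else 1) *
          removalWeight H d (W.erase i) := by
      intro i hi
      refine mul_le_mul_of_nonneg_left (ih (by omega) _ ?_) ?_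
      · rw [Finset.card_erase_of_mem hi]; omega
      · split_ifs <;> norm_num
    refine le_trans ?_ (Finset.sum_le_sum hstep)
    rw [← Finset.sum_mul]
    have hsum : ∑ i ∈ W, (if i ∈ avoidRegion H (W.erase i) then (1 / 2 : ℝ) else 1) =
        W.card - (essential H W).card / 2 := by
      have : ∀ i ∈ W, (if i ∈ avoidRegion H (W.erase i) then (1 / 2 : ℝ) else 1) =
          1 - (if i ∈ avoidRegion H (W.erase i) then (1 : ℝ) else 0) / 2 := by
        intro i _
        split_ifs <;> norm_num
      rw [Finset.sum_congr rfl this, Finset.sum_sub_distrib, ← Finset.sum_div,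
        Finset.sum_boole]
      simp [essential]
    rw [hsum]
    set h : ℝ := (((essential H W).card : ℕ) : ℝ) with hh
    have h1 : h ≤ W.card := by
      rw [hh]; exact_mod_cast Finset.card_le_card (Finset.filter_subset _ _)
    have h2 : h ≤ m := by rw [hh]; exact_mod_cast hstar W (by omega)
    have h0 : 0 ≤ h := by positivity
    have hWa : (a : ℝ) ≤ W.card := by rw [hW]; push_cast; linarith
    have h3 := exp_neg_le_one_sub_half (x := h / W.card) (by positivity)
      ((div_le_one hWpos).2 h1)
    have h4 : Real.exp (-(m / a : ℝ)) ≤ Real.exp (-(h / W.card)) := by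
      apply Real.exp_le_exp.2
      rw [neg_le_neg_iff]
      gcongr
    have h5 : (W.card : ℝ) - h / 2 = W.card * (1 - h / W.card / 2) := by
      field_simp
    have h6 : -(m * ((d + 1 : ℕ) : ℝ) / a : ℝ) = -(m / a : ℝ) + -(m * d / a : ℝ) := by
      push_cast; field_simp; ring
    rw [h6, Real.exp_add, h5, mul_right_comm]
    refine mul_le_mul_of_nonneg_right ?_ (Real.exp_pos _).le
    rw [mul_comm]
    exact mul_le_mul_of_nonneg_left (h4.trans h3) hWpos.le

/-- Reverses time: removing a uniform point from a uniform `(t + 1)`-set is the same as adding a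
uniform outside point to a uniform `t`-set. -/
theorem sum_powersetCard_succ_erase {M : Type*} [AddCommMonoid M] (t : ℕ)
    (φ : Finset ι → ι → M) :
    ∑ W ∈ powersetCard (t + 1) (univ : Finset ι), ∑ i ∈ W, φ (W.erase i) i =
      ∑ T ∈ powersetCard t (univ : Finset ι), ∑ i ∈ Tᶜ, φ T i := by
  rw [Finset.sum_sigma', Finset.sum_sigma']
  refine Finset.sum_bij' (fun p _ => ⟨p.1.erase p.2, p.2⟩) (fun p _ => ⟨insert p.2 p.1, p.2⟩)
    ?_ ?_ ?_ ?_ ?_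
  · rintro ⟨W, i⟩ h
    simp only [mem_sigma, mem_powersetCard, subset_univ, true_and] at h
    simp [Finset.card_erase_of_mem h.2, h.1]
  · rintro ⟨T, i⟩ h
    simp only [mem_sigma, mem_powersetCard, subset_univ, true_and, mem_compl] at h
    simp [Finset.card_insert_of_notMem h.2, h.1]
  · rintro ⟨W, i⟩ h
    simp only [mem_sigma, mem_powersetCard, subset_univ, true_and] at h
    simp [Finset.insert_erase h.2]
  · rintro ⟨T, i⟩ h
    simp only [mem_sigma, mem_powersetCard, subset_univ, true_and, mem_compl] at h
    simp [Finset.erase_insert h.2]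
  · rintro ⟨W, i⟩ h
    rfl

theorem sum_compl_half_le (H : Finset (Finset ι)) (L : ℕ) (T : Finset ι)
    (hL : L ≤ (avoidRegion H T).card) :
    ∑ i ∈ Tᶜ, (if i ∈ avoidRegion H T then (1 / 2 : ℝ) else 1) ≤
      (Fintype.card ι - T.card : ℝ) * Real.exp (-(L / (2 * Fintype.card ι) : ℝ)) := by
  have : ∀ i ∈ Tᶜ, (if i ∈ avoidRegion H T then (1 / 2 : ℝ) else 1) =
      1 - (if i ∈ avoidRegion H T then (1 : ℝ) else 0) / 2 := by
    intro i _
    split_ifs <;> norm_num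
  rw [Finset.sum_congr rfl this, Finset.sum_sub_distrib, ← Finset.sum_div, Finset.sum_boole]
  have hf : Tᶜ.filter (fun i => i ∈ avoidRegion H T) = avoidRegion H T := by
    ext i
    simp only [mem_filter, mem_compl, and_iff_right_iff_imp]
    exact fun hi => Finset.disjoint_left.1 (disjoint_avoidRegion H T) hi
  rw [hf]
  have hc : (Tᶜ.card : ℝ) = Fintype.card ι - T.card := by
    rw [Finset.card_compl, Nat.cast_sub (Finset.card_le_univ T)]
  have hT : (T.card : ℝ) ≤ Fintype.card ι := by exact_mod_cast Finset.card_le_univ T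
  simp only [sum_const, nsmul_eq_mul, mul_one, hc]
  have hL' : (L : ℝ) ≤ (avoidRegion H T).card := by exact_mod_cast hL
  rcases (Nat.cast_nonneg (α := ℝ) (Fintype.card ι)).eq_or_lt with h0 | hpos
  · have : (T.card : ℝ) = 0 := le_antisymm (h0 ▸ hT) (by positivity)
    rw [← h0, this]
    have : (0 : ℝ) ≤ (avoidRegion H T).card := by positivity
    linarith
  · have hexp := Real.add_one_le_exp (-(L / (2 * Fintype.card ι) : ℝ))
    have h2 := mul_le_mul_of_nonneg_left hexp (sub_nonneg.2 hT)
    refine le_trans ?_ h2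
    have h3 : (Fintype.card ι - T.card : ℝ) * (L / (2 * Fintype.card ι)) ≤ L / 2 := by
      have : (Fintype.card ι - T.card : ℝ) / Fintype.card ι ≤ 1 := by
        rw [div_le_one hpos]; have : (0 : ℝ) ≤ T.card := by positivity
        linarith
      calc (Fintype.card ι - T.card : ℝ) * (L / (2 * Fintype.card ι))
          = (Fintype.card ι - T.card : ℝ) / Fintype.card ι * (L / 2) := by field_simp
        _ ≤ 1 * (L / 2) := by gcongr
        _ = L / 2 := one_mul _
    nlinarith

/-- Induction on `d` in the reversed direction: the point added to `T` falls in a region of size at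
least `L` among at most `N` candidates, so its weight averages at most `exp (-L / (2 * N))`. -/
theorem sum_removalWeight_le (H : Finset (Finset ι)) (L a d : ℕ) :
    ∑ W ∈ powersetCard (a + d) (univ : Finset ι),
        (if L ≤ (avoidRegion H W).card then removalWeight H d W else 0) ≤
      (Fintype.card ι).choose (a + d) * Real.exp (-(L * d / (2 * Fintype.card ι) : ℝ)) := by
  induction d with
  | zero =>
    refine (Finset.sum_le_card_nsmul _ _ 1 ?_).trans ?_
    · intro W _
      split_ifs <;> simp [removalWeight]
    · simp
  | succ d ih =>
    set N := Fintype.card ι with hN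
    have hexp : Real.exp (-(L * ((d + 1 : ℕ) : ℝ) / (2 * N) : ℝ)) =
        Real.exp (-(L / (2 * N) : ℝ)) * Real.exp (-(L * d / (2 * N) : ℝ)) := by
      rw [← Real.exp_add]
      congr 1
      push_cast
      ring
    have hchoose : ((N.choose (a + (d + 1)) : ℕ) : ℝ) * (a + d + 1) =
        (N.choose (a + d) : ℝ) * (N - (a + d : ℕ) : ℝ) := by
      rcases le_or_gt (a + d) N with hle | hlt
      · have := Nat.choose_succ_right_eq N (a + d)
        rw [← Nat.cast_sub hle]
        exact_mod_cast this
      · rw [Nat.choose_eq_zero_of_lt hlt, Nat.choose_eq_zero_of_lt (by omega)]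
        simp
    have hpos : (0 : ℝ) < a + d + 1 := by positivity
    have h1 : ∀ W ∈ powersetCard (a + (d + 1)) (univ : Finset ι),
        (if L ≤ (avoidRegion H W).card then removalWeight H (d + 1) W else 0) * (a + d + 1 : ℝ) ≤
        ∑ i ∈ W, (if L ≤ (avoidRegion H (W.erase i)).card then
          (if i ∈ avoidRegion H (W.erase i) then (1 / 2 : ℝ) else 1) *
            removalWeight H d (W.erase i) else 0) := by
      intro W hW
      have hWc : (W.card : ℝ) = a + d + 1 := by
        rw [(mem_powersetCard.1 hW).2]; push_cast; ring
      split_ifs with hLW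
      · rw [removalWeight, hWc, div_mul_cancel₀ _ hpos.ne']
        refine Finset.sum_le_sum fun i _ => ?_
        -- The region only grows when points are removed, so the largeness condition passes from `W`
        -- to `W.erase i`.
        rw [if_pos (hLW.trans (Finset.card_le_card (avoidRegion_anti H (W.erase_subset i))))]
      · rw [zero_mul]
        refine Finset.sum_nonneg fun i _ => ?_
        have := removalWeight_nonneg H d (W.erase i)
        split_ifs <;> positivity
    refine le_of_mul_le_mul_right ?_ hpos
    rw [Finset.sum_mul]
    refine (Finset.sum_le_sum h1).trans ?_
    have h2 := sum_powersetCard_succ_erase (ι := ι) (a + d) (fun T i =>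
      (if L ≤ (avoidRegion H T).card then
          (if i ∈ avoidRegion H T then (1 / 2 : ℝ) else 1) * removalWeight H d T else 0))
    rw [show a + (d + 1) = a + d + 1 from rfl, h2]
    have h3 : ∀ T ∈ powersetCard (a + d) (univ : Finset ι),
        ∑ i ∈ Tᶜ, (if L ≤ (avoidRegion H T).card then
          (if i ∈ avoidRegion H T then (1 / 2 : ℝ) else 1) * removalWeight H d T else 0) ≤
        ((N - (a + d : ℕ) : ℝ) * Real.exp (-(L / (2 * N) : ℝ))) *
          (if L ≤ (avoidRegion H T).card then removalWeight H d T else 0) := by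
      intro T hT
      split_ifs with hLT
      · rw [← Finset.sum_mul]
        refine mul_le_mul_of_nonneg_right ?_ (removalWeight_nonneg H d T)
        have := sum_compl_half_le H L T hLT
        rwa [(mem_powersetCard.1 hT).2] at this
      · simp
    refine (Finset.sum_le_sum h3).trans ?_
    rw [← Finset.mul_sum]
    rcases le_or_gt (a + d) N with hle | hlt
    · have hnn : (0 : ℝ) ≤ N - (a + d : ℕ) := by
        rw [sub_nonneg]; exact_mod_cast hle
      refine (mul_le_mul_of_nonneg_left ih (by positivity)).trans (le_of_eq ?_)
      rw [hexp, mul_right_comm, ← add_assoc] at *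
      rw [show (N.choose (a + d + 1) : ℝ) * (Real.exp (-(L / (2 * N) : ℝ)) *
        Real.exp (-(L * d / (2 * N) : ℝ))) * (a + d + 1) = (N.choose (a + d + 1) : ℝ) * (a + d + 1) *
        (Real.exp (-(L / (2 * N) : ℝ)) * Real.exp (-(L * d / (2 * N) : ℝ))) by ring]
      have hchoose' : ((N.choose (a + d + 1) : ℕ) : ℝ) * (a + d + 1) =
        (N.choose (a + d) : ℝ) * (N - (a + d : ℕ) : ℝ) := hchoose
      rw [hchoose']
      ring
    · rw [Finset.powersetCard_eq_empty.2 (by rw [Finset.card_univ]; exact hlt), Finset.sum_empty,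
        mul_zero]
      positivity

/-- Markov's inequality for `removalWeight`: its pointwise lower bound is played against the bound
for its sum over sets with a large region. -/
theorem card_le_card_avoidRegion_mul_exp_le (H : Finset (Finset ι)) {m n a d : ℕ} (L : ℕ)
    (ha : 0 < a) (hn : a + d ≤ n)
    (hstar : ∀ W : Finset ι, W.card ≤ n → (essential H W).card ≤ m) :
    (((powersetCard (a + d) (univ : Finset ι)).filter
        fun W => L ≤ (avoidRegion H W).card).card : ℝ) ≤
      (Fintype.card ι).choose (a + d) *
        Real.exp (m * d / a - L * d / (2 * Fintype.card ι) : ℝ) := by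
  have h := sum_removalWeight_le H L a d
  have h2 : ∑ W ∈ powersetCard (a + d) (univ : Finset ι),
      (if L ≤ (avoidRegion H W).card then Real.exp (-(m * d / a : ℝ)) else 0) ≤
      ∑ W ∈ powersetCard (a + d) (univ : Finset ι),
        (if L ≤ (avoidRegion H W).card then removalWeight H d W else 0) := by
    refine Finset.sum_le_sum fun W hW => ?_
    split_ifs
    · exact exp_le_removalWeight H ha hstar d hn W (mem_powersetCard.1 hW).2
    · rfl
  have h3 := h2.trans h
  rw [← Finset.sum_filter, Finset.sum_const, nsmul_eq_mul, Real.exp_neg] at h3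
  have := Real.exp_pos (m * d / a : ℝ)
  rw [← div_eq_mul_inv, div_le_iff₀ this] at h3
  refine h3.trans (le_of_eq ?_)
  rw [sub_eq_add_neg, Real.exp_add]
  ring

/-! ### Two-stage sampling and the union bound over error patterns. -/

/-- A uniform `r`-subset of `M ≤ 3 * r` points misses a given set of `e` points with probability at
most `(2/3) ^ e`: each excluded point contributes a factor `1 - r / M'` with `M' ≤ M`. -/
theorem three_pow_mul_choose_sub_le {M r : ℕ} (hr : 0 < r) (hM : M ≤ 3 * r) (e : ℕ) :
    3 ^ e * (M - e).choose r ≤ 2 ^ e * M.choose r := by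
  induction e with
  | zero => simp
  | succ e ih =>
    rcases Nat.eq_zero_or_pos (M - e) with h0 | hpos
    · rw [show M - (e + 1) = 0 by omega, Nat.choose_eq_zero_of_lt hr]
      simp
    · obtain ⟨q, hq⟩ : ∃ q, M - e = q + 1 := ⟨M - e - 1, by omega⟩
      rw [hq] at ih
      rw [show M - (e + 1) = q by omega]
      have h1 := Nat.choose_mul_succ_eq q r
      have h2 : 3 * q.choose r ≤ 2 * (q + 1).choose r := by
        refine Nat.le_of_mul_le_mul_right ?_ (Nat.succ_pos q)
        calc 3 * q.choose r * (q + 1) = (q + 1).choose r * (3 * (q + 1 - r)) := by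
              rw [mul_assoc, h1]; ring
          _ ≤ (q + 1).choose r * (2 * (q + 1)) := Nat.mul_le_mul_left _ (by omega)
          _ = 2 * (q + 1).choose r * (q + 1) := by ring
      calc 3 ^ (e + 1) * q.choose r = 3 ^ e * (3 * q.choose r) := by ring
        _ ≤ 3 ^ e * (2 * (q + 1).choose r) := Nat.mul_le_mul_left _ h2
        _ = 2 * (3 ^ e * (q + 1).choose r) := by ring
        _ ≤ 2 * (2 ^ e * M.choose r) := Nat.mul_le_mul_left _ ih
        _ = _ := by ring

theorem card_superset_disjoint_le (n : ℕ) (T₁ E : Finset ι) (hd : Disjoint E T₁) :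
    ((powersetCard n (univ : Finset ι)).filter fun T => T₁ ⊆ T ∧ Disjoint E T).card ≤
      (Fintype.card ι - T₁.card - E.card).choose (n - T₁.card) := by
  have hc : (T₁ ∪ E)ᶜ.card = Fintype.card ι - T₁.card - E.card := by
    rw [Finset.card_compl, Finset.card_union_of_disjoint hd.symm]; omega
  rw [← hc, ← Finset.card_powersetCard]
  refine Finset.card_le_card_of_injOn (fun T => T \ T₁) ?_ ?_
  · intro T hT
    simp only [coe_filter, mem_powersetCard, subset_univ, true_and, Set.mem_ofPred_eq] at hT
    simp only [Finset.mem_coe, mem_powersetCard]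
    refine ⟨?_, by rw [Finset.card_sdiff_of_subset hT.2.1, hT.1]⟩
    intro i hi
    simp only [mem_sdiff] at hi
    simp only [mem_compl, mem_union, not_or]
    exact ⟨hi.2, Finset.disjoint_right.1 hT.2.2 hi.1⟩
  · intro T hT T' hT' h
    simp only [coe_filter, mem_powersetCard, subset_univ, true_and, Set.mem_ofPred_eq] at hT hT'
    simp only at h
    rw [← Finset.sdiff_union_of_subset hT.2.1, h, Finset.sdiff_union_of_subset hT'.2.1]

/-- A pattern avoiding `T ⊇ T₁` avoids `T₁`, hence lies in `avoidRegion H T₁`; at most `G` patterns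
do, and the union bound runs over these alone. -/
theorem card_superset_avoiding_le (H : Finset (Finset ι)) (k n L G : ℕ) (T₁ : Finset ι)
    (hT : T₁.card < n) (hN : Fintype.card ι - T₁.card ≤ 3 * (n - T₁.card))
    (hL : (avoidRegion H T₁).card ≤ L)
    (hG : ∀ D : Finset ι, D.card ≤ L → (H.filter fun E => E ⊆ D).card ≤ G) :
    (((powersetCard n (univ : Finset ι)).filter
        fun T => T₁ ⊆ T ∧ ∃ E ∈ H, Disjoint E T ∧ k ≤ E.card).card : ℝ) ≤
      G * (2 / 3 : ℝ) ^ k * (Fintype.card ι - T₁.card).choose (n - T₁.card) := by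
  set R : Finset (Finset ι) := (H.filter fun E => E ⊆ avoidRegion H T₁).filter
    fun E => Disjoint E T₁ ∧ k ≤ E.card with hR
  have hsub : ((powersetCard n (univ : Finset ι)).filter
      fun T => T₁ ⊆ T ∧ ∃ E ∈ H, Disjoint E T ∧ k ≤ E.card) ⊆
      R.biUnion fun E => (powersetCard n (univ : Finset ι)).filter
        fun T => T₁ ⊆ T ∧ Disjoint E T := by
    intro T hT'
    simp only [mem_filter] at hT'
    obtain ⟨hTn, hTT, E, hE, hd, hk⟩ := hT'
    have hd1 : Disjoint E T₁ := hd.mono_right hTT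
    simp only [mem_biUnion, hR, mem_filter]
    exact ⟨E, ⟨⟨hE, fun i hi => mem_avoidRegion.2 ⟨E, hE, hd1, hi⟩⟩, hd1, hk⟩, hTn, hTT, hd⟩
  have hone : ∀ E ∈ R, (((powersetCard n (univ : Finset ι)).filter
      fun T => T₁ ⊆ T ∧ Disjoint E T).card : ℝ) ≤
      (2 / 3 : ℝ) ^ k * (Fintype.card ι - T₁.card).choose (n - T₁.card) := by
    intro E hE
    simp only [hR, mem_filter] at hE
    have h1 := card_superset_disjoint_le n T₁ E hE.2.1
    have h2 := three_pow_mul_choose_sub_le (M := Fintype.card ι - T₁.card)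
      (r := n - T₁.card) (by omega) hN k
    have h3 : (Fintype.card ι - T₁.card - E.card).choose (n - T₁.card) ≤
        (Fintype.card ι - T₁.card - k).choose (n - T₁.card) :=
      Nat.choose_le_choose _ (by have := hE.2.2; omega)
    have h4 : (((powersetCard n (univ : Finset ι)).filter
      fun T => T₁ ⊆ T ∧ Disjoint E T).card : ℝ) ≤
        (Fintype.card ι - T₁.card - k).choose (n - T₁.card) := by exact_mod_cast h1.trans h3
    have h5 : (3 : ℝ) ^ k * (Fintype.card ι - T₁.card - k).choose (n - T₁.card) ≤
        2 ^ k * (Fintype.card ι - T₁.card).choose (n - T₁.card) := by exact_mod_cast h2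
    refine h4.trans ?_
    rw [div_pow, div_mul_eq_mul_div, le_div_iff₀ (by positivity), mul_comm]
    exact h5
  have hcard : R.card ≤ G := (Finset.card_filter_le _ _).trans (hG _ hL)
  calc _ ≤ ((∑ E ∈ R, ((powersetCard n (univ : Finset ι)).filter
        fun T => T₁ ⊆ T ∧ Disjoint E T).card : ℕ) : ℝ) := by
        exact_mod_cast (Finset.card_le_card hsub).trans Finset.card_biUnion_le
    _ ≤ R.card • ((2 / 3 : ℝ) ^ k * (Fintype.card ι - T₁.card).choose (n - T₁.card)) := by
        push_cast
        exact Finset.sum_le_card_nsmul _ _ _ hone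
    _ ≤ _ := by
        rw [nsmul_eq_mul, mul_assoc]
        gcongr

/-- If few points of any set are essential for `H`, then a random `n`-subset of `2 n` points
rarely avoids a large member of `H`. -/
theorem card_avoiding_le (H : Finset (Finset ι)) (k n a d m L G : ℕ)
    (hcard : Fintype.card ι = 2 * n) (ha : 0 < a) (hd : 2 * (a + d) ≤ n)
    (hstar : ∀ W : Finset ι, W.card ≤ n → (essential H W).card ≤ m)
    (hG : ∀ D : Finset ι, D.card ≤ L → (H.filter fun E => E ⊆ D).card ≤ G) :
    (((powersetCard n (univ : Finset ι)).filter
        fun T => ∃ E ∈ H, Disjoint E T ∧ k ≤ E.card).card : ℝ) ≤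
      (2 * n).choose n *
        (Real.exp (m * d / a - L * d / (2 * (2 * n)) : ℝ) + G * (2 / 3 : ℝ) ^ k) := by
  set b := a + d with hb
  have hbn : b < n := by omega
  set c : ℝ := (((2 * n - b).choose (n - b) : ℕ) : ℝ) with hc
  have hpt : ∀ T₁ ∈ powersetCard b (univ : Finset ι),
      (((powersetCard n (univ : Finset ι)).filter
        fun T => T₁ ⊆ T ∧ ∃ E ∈ H, Disjoint E T ∧ k ≤ E.card).card : ℝ) ≤
      (if L ≤ (avoidRegion H T₁).card then c else 0) + G * (2 / 3 : ℝ) ^ k * c := by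
    intro T₁ hT₁
    have hT₁ : T₁.card = b := (mem_powersetCard.1 hT₁).2
    split_ifs with hL
    · have h1 : ((powersetCard n (univ : Finset ι)).filter
          fun T => T₁ ⊆ T ∧ ∃ E ∈ H, Disjoint E T ∧ k ≤ E.card).card ≤
          ((powersetCard n (univ : Finset ι)).filter
            fun T => T₁ ⊆ T ∧ Disjoint (∅ : Finset ι) T).card := by
        refine Finset.card_le_card fun T hT => ?_
        simp only [mem_filter] at hT ⊢
        exact ⟨hT.1, hT.2.1, disjoint_bot_left⟩
      have h2 := h1.trans (card_superset_disjoint_le n T₁ ∅ disjoint_bot_left)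
      rw [hT₁, hcard, Finset.card_empty, Nat.sub_zero] at h2
      have h3 : (0 : ℝ) ≤ G * (2 / 3 : ℝ) ^ k * c := by positivity
      have h4 : (((powersetCard n (univ : Finset ι)).filter
        fun T => T₁ ⊆ T ∧ ∃ E ∈ H, Disjoint E T ∧ k ≤ E.card).card : ℝ) ≤ c := by
        rw [hc]; exact_mod_cast h2
      linarith
    · have := card_superset_avoiding_le H k n L G T₁ (by omega) (by omega) (by omega) hG
      rw [hT₁, hcard] at this
      rw [zero_add]
      exact this
  -- Each `n`-set has `n.choose b` subsets of size `b`, so a uniform `T` may be drawn as a uniform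
  -- `T₁` followed by a uniform completion.
  have hdouble : (((powersetCard n (univ : Finset ι)).filter
        fun T => ∃ E ∈ H, Disjoint E T ∧ k ≤ E.card).card : ℝ) * n.choose b =
      ∑ T₁ ∈ powersetCard b (univ : Finset ι), (((powersetCard n (univ : Finset ι)).filter
        fun T => T₁ ⊆ T ∧ ∃ E ∈ H, Disjoint E T ∧ k ≤ E.card).card : ℝ) := by
    have h := Finset.sum_card_bipartiteAbove_eq_sum_card_bipartiteBelow
      (s := powersetCard b (univ : Finset ι))
      (t := (powersetCard n (univ : Finset ι)).filter
        fun T => ∃ E ∈ H, Disjoint E T ∧ k ≤ E.card) (fun T₁ T => T₁ ⊆ T)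
    have h1 : ∀ T ∈ (powersetCard n (univ : Finset ι)).filter
        (fun T => ∃ E ∈ H, Disjoint E T ∧ k ≤ E.card),
        ((powersetCard b (univ : Finset ι)).bipartiteBelow (fun T₁ T => T₁ ⊆ T) T).card =
          n.choose b := by
      intro T hT
      have hTn : T.card = n := (mem_powersetCard.1 (mem_filter.1 hT).1).2
      rw [← hTn, ← Finset.card_powersetCard, Finset.bipartiteBelow]
      congr 1
      ext T₁
      simp [mem_powersetCard, and_comm]
    rw [Finset.sum_congr rfl h1, Finset.sum_const, smul_eq_mul] at h
    rw [← Nat.cast_mul, ← h, Nat.cast_sum]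
    refine Finset.sum_congr rfl fun T₁ _ => ?_
    rw [Finset.bipartiteAbove, Finset.filter_filter]
    simp only [and_comm]
  have hbad := card_le_card_avoidRegion_mul_exp_le H (m := m) (n := n) (a := a) (d := d) L ha
    (by omega) hstar
  rw [← hb, hcard] at hbad
  have hmul : ((2 * n).choose n : ℝ) * n.choose b = (2 * n).choose b * c := by
    rw [hc]
    exact_mod_cast Nat.choose_mul (n := 2 * n) (k := n) (s := b) hbn.le
  have hpos : (0 : ℝ) < n.choose b := by exact_mod_cast Nat.choose_pos hbn.le
  refine le_of_mul_le_mul_right ?_ hpos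
  rw [hdouble]
  refine (Finset.sum_le_sum hpt).trans ?_
  rw [Finset.sum_add_distrib, ← Finset.sum_filter, Finset.sum_const, Finset.sum_const,
    Finset.card_powersetCard, Finset.card_univ, hcard, nsmul_eq_mul, nsmul_eq_mul]
  have h := mul_le_mul_of_nonneg_right hbad (by positivity : 0 ≤ c)
  push_cast at h
  calc _ ≤ (2 * n).choose b * Real.exp (m * d / a - L * d / (2 * (2 * n)) : ℝ) * c +
        (2 * n).choose b * (G * (2 / 3 : ℝ) ^ k * c) := by linarith
    _ = (2 * n).choose b * c *
        (Real.exp (m * d / a - L * d / (2 * (2 * n)) : ℝ) + G * (2 / 3 : ℝ) ^ k) := by ring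
    _ = _ := by rw [← hmul]; ring

end Combinatorics

end ERMStar

namespace ERMStar

/-! ### Submultiplicativity and monotonicity of the growth function. -/

section Growth

variable {X : Type u} {F : Set (X → Label)}

theorem ncard_projection_le_two_pow {k : ℕ} (x : Fin k → X) :
    (projection F x).ncard ≤ 2 ^ k := by
  refine (Set.ncard_le_ncard (Set.subset_univ _)).trans ?_
  simp [Set.ncard_univ]

theorem ncard_projection_le_growth {k : ℕ} (x : Fin k → X) :
    (projection F x).ncard ≤ growth F k :=
  le_ciSup (f := fun x : Fin k → X => (projection F x).ncard)
    ⟨2 ^ k, by rintro _ ⟨x, rfl⟩; exact ncard_projection_le_two_pow x⟩ x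

theorem growth_le_two_pow (k : ℕ) : growth F k ≤ 2 ^ k :=
  ciSup_le' fun x => ncard_projection_le_two_pow x

theorem growth_add_le (a b : ℕ) : growth F (a + b) ≤ growth F a * growth F b := by
  refine ciSup_le' fun x => ?_
  refine le_trans ?_ (Nat.mul_le_mul (ncard_projection_le_growth fun i => x (Fin.castAdd b i))
    (ncard_projection_le_growth fun i => x (Fin.natAdd a i)))
  rw [← Set.ncard_prod]
  refine Set.ncard_le_ncard_of_injOn
    (fun y => (fun i => y (Fin.castAdd b i), fun i => y (Fin.natAdd a i))) ?_ ?_ (Set.toFinite _)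
  · rintro _ ⟨f, hf, rfl⟩
    exact ⟨⟨f, hf, rfl⟩, ⟨f, hf, rfl⟩⟩
  · intro y _ y' _ h
    simp only [Prod.mk.injEq] at h
    funext i
    refine Fin.addCases (fun i => congrFun h.1 i) (fun i => congrFun h.2 i) i

theorem growth_mul_le (c m : ℕ) : growth F (c * m) ≤ growth F m ^ c := by
  induction c with
  | zero => simpa using growth_le_two_pow (F := F) 0
  | succ c ih =>
    rw [Nat.succ_mul, pow_succ]
    exact (growth_add_le _ _).trans (Nat.mul_le_mul_right _ ih)

/-- Extra points are padded with an arbitrary `x₀`. On an empty space this fails: `growth F 0` is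
`1` for nonempty `F`, while larger arguments give an empty supremum, which is `0`. -/
theorem growth_mono [Nonempty X] : Monotone (growth F) := by
  classical
  intro a c hac
  refine ciSup_le' fun x => ?_
  obtain ⟨x₀⟩ := ‹Nonempty X›
  let x' : Fin c → X := fun i => if h : i.1 < a then x ⟨i, h⟩ else x₀
  have : projection F x = (fun y i => y (Fin.castLE hac i)) '' projection F x' := by
    rw [projection, projection, Set.image_image]
    refine Set.image_congr fun f _ => ?_
    funext i
    simp [x']
  rw [this]
  exact (Set.ncard_image_le (Set.toFinite _)).trans (ncard_projection_le_growth x')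

theorem le_exp_tlog (x : ℝ) : x ≤ Real.exp (tlog x) := by
  rw [tlog, Real.exp_log (lt_of_lt_of_le (Real.exp_pos 1) (le_max_right _ _))]
  exact le_max_left _ _

theorem one_le_tlog (x : ℝ) : 1 ≤ tlog x := by
  rw [tlog, Real.le_log_iff_exp_le (lt_of_lt_of_le (Real.exp_pos 1) (le_max_right _ _))]
  exact le_max_right _ _

theorem growth_mul_add_le_exp (c m j : ℕ) :
    (growth F (c * m + j) : ℝ) ≤ Real.exp (c * tlog (growth F m) + j) := by
  have h : (growth F (c * m + j) : ℝ) ≤ (growth F m : ℝ) ^ c * 2 ^ j := by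
    exact_mod_cast (growth_add_le _ _).trans (Nat.mul_le_mul (growth_mul_le c m)
      (growth_le_two_pow j))
  refine h.trans ?_
  rw [Real.exp_add, Real.exp_nat_mul]
  have h2 : (2 : ℝ) ≤ Real.exp 1 := by have := Real.add_one_le_exp 1; linarith
  have h3 : Real.exp j = Real.exp 1 ^ j := by rw [← Real.exp_nat_mul, mul_one]
  rw [h3]
  gcongr
  exact le_exp_tlog _

end Growth

/-! ### Error patterns, stars, and the choice of constants. -/

section Patterns

variable {X : Type u} {ι : Type*} [Fintype ι]

/-- The indices of the points at which `f` disagrees with `g`. -/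
def errorPattern (g f : X → Label) (x : ι → X) : Finset ι :=
  Finset.univ.filter fun i => f (x i) ≠ g (x i)

theorem mem_errorPattern {g f : X → Label} {x : ι → X} {i : ι} :
    i ∈ errorPattern g f x ↔ f (x i) ≠ g (x i) := by
  simp [errorPattern]

open Classical in
/-- The disagreement patterns of the members of `F` with `g`. -/
noncomputable def errorPatterns (F : Set (X → Label)) (g : X → Label) (x : ι → X) :
    Finset (Finset ι) :=
  Finset.univ.filter fun E => ∃ f ∈ F, errorPattern g f x = E

theorem mem_errorPatterns {F : Set (X → Label)} {g : X → Label} {x : ι → X} {E : Finset ι} :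
    E ∈ errorPatterns F g x ↔ ∃ f ∈ F, errorPattern g f x = E := by
  simp [errorPatterns]

variable [DecidableEq ι]

/-- For each essential point some classifier differs from `g` there and nowhere else on `W`, in
particular at no other essential point: a star with centre `g`. The same separation makes the points
distinct in `X`, even if `x` is not injective. -/
theorem hasStar_card_essential {F : Set (X → Label)} {g : X → Label} (hg : g ∈ F) (x : ι → X)
    (W : Finset ι) : HasStar F (essential (errorPatterns F g x) W).card := by
  set S := essential (errorPatterns F g x) W with hS
  let e := S.equivFin.symm
  have hmem : ∀ j, (e j : ι) ∈ W := fun j => (Finset.mem_filter.1 (e j).2).1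
  have hex : ∀ j, ∃ f ∈ F, f (x (e j)) ≠ g (x (e j)) ∧
      ∀ j', j' ≠ j → f (x (e j')) = g (x (e j')) := by
    intro j
    obtain ⟨E, hE, hd, hi⟩ := mem_avoidRegion.1 (Finset.mem_filter.1 (e j).2).2
    obtain ⟨f, hf, rfl⟩ := mem_errorPatterns.1 hE
    refine ⟨f, hf, mem_errorPattern.1 hi, fun j' hj' => ?_⟩
    have hne : (e j' : ι) ≠ e j := fun h => hj' (e.injective (Subtype.ext h))
    have := Finset.disjoint_right.1 hd (Finset.mem_erase.2 ⟨hne, hmem j'⟩)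
    rw [mem_errorPattern, not_not] at this
    exact this
  choose f hf hne heq using hex
  refine ⟨fun j => x (e j), ?_, g, hg, f, hf, ?_⟩
  · intro j j' h
    by_contra hjj
    simp only at h
    exact hne j (by rw [h]; exact heq j j' (Ne.symm hjj))
  · intro j
    ext z
    simp only [DIS, Set.mem_inter_iff, Set.mem_ofPred_eq, Set.mem_range, Set.mem_singleton_iff]
    constructor
    · rintro ⟨⟨h₁, hh₁, h₂, hh₂, hz⟩, j', rfl⟩
      by_contra hcon
      have hjj : j' ≠ j := by rintro rfl; exact hcon rfl
      have := heq j j' hjj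
      rcases hh₁ with rfl | rfl <;> rcases hh₂ with rfl | rfl <;> simp_all
    · rintro rfl
      exact ⟨⟨g, Or.inl rfl, f j, Or.inr rfl, (hne j).symm⟩, j, rfl⟩

theorem card_essential_le {F : Set (X → Label)} {g : X → Label} (hg : g ∈ F) (x : ι → X)
    (W : Finset ι) {n : ℕ} (hW : W.card ≤ n) :
    (essential (errorPatterns F g x) W).card ≤ (min (starNumber F) (n : ℕ∞)).toNat := by
  have h1 : ((essential (errorPatterns F g x) W).card : ℕ∞) ≤ starNumber F :=
    le_iSup₂ (f := fun (k : ℕ) (_ : HasStar F k) => (k : ℕ∞)) _ (hasStar_card_essential hg x W)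
  have h2 : ((essential (errorPatterns F g x) W).card : ℕ∞) ≤ n := by
    exact_mod_cast (Finset.card_filter_le _ _).trans hW
  have h3 : min (starNumber F) (n : ℕ∞) ≠ ⊤ :=
    ne_top_of_le_ne_top (ENat.natCast_ne_top n) (min_le_right _ _)
  have := ENat.toNat_le_toNat (le_min h1 h2) h3
  simpa using this

/-- With two labels, an error pattern inside `D` and the labelling it induces on `D` determine each
other, a pattern marking where `g` is negated. -/
theorem card_errorPatterns_subset_le (F : Set (X → Label)) (g : X → Label) (x : ι → X)
    (D : Finset ι) :
    ((errorPatterns F g x).filter fun E => E ⊆ D).card ≤ growth F D.card := by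
  let e := D.equivFin.symm
  refine le_trans ?_ (ncard_projection_le_growth (F := F) fun j => x (e j))
  rw [← Set.ncard_coe_finset]
  classical
  refine Set.ncard_le_ncard_of_injOn
    (fun E j => if (e j : ι) ∈ E then -g (x (e j)) else g (x (e j))) ?_ ?_ (Set.toFinite _)
  · intro E hE
    simp only [Finset.coe_filter, mem_errorPatterns, Set.mem_ofPred_eq] at hE
    obtain ⟨⟨f, hf, rfl⟩, -⟩ := hE
    refine ⟨f, hf, ?_⟩
    funext j
    simp only [mem_errorPattern]
    split_ifs with h
    · exact Int.units_ne_iff_eq_neg.1 h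
    · exact not_not.1 h
  · intro E hE E' hE' h
    simp only [Finset.coe_filter, Set.mem_ofPred_eq] at hE hE'
    have key : ∀ i ∈ D, (i ∈ E ↔ i ∈ E') := by
      intro i hi
      have := congrFun h (D.equivFin ⟨i, hi⟩)
      simp only [e, Equiv.symm_apply_apply] at this
      have hneg : -g (x i) ≠ g (x i) := Int.units_ne_iff_eq_neg.2 rfl
      split_ifs at this with h1 h2 h2
      · exact iff_of_true h1 h2
      · exact absurd this hneg
      · exact absurd this.symm hneg
      · exact iff_of_false h1 h2
    ext i
    by_cases hi : i ∈ D
    · exact key i hi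
    · exact ⟨fun h => absurd (hE.2 h) hi, fun h => absurd (hE'.2 h) hi⟩

end Patterns

/-- Among the `n`-subsets of `2 n` points, few are consistent with a classifier from `F` that
makes many errors. -/
theorem card_consistent_le {X : Type u} {F : Set (X → Label)} {g : X → Label} (hg : g ∈ F)
    {ι : Type*} [Fintype ι] [DecidableEq ι] (x : ι → X) {n : ℕ} (hn : 4 ≤ n)
    (hι : Fintype.card ι = 2 * n) {q t : ℝ}
    (hq : q = tlog (growth F (min (starNumber F) (n : ℕ∞)).toNat)) (ht : 1 ≤ t) :
    (((Finset.powersetCard n (Finset.univ : Finset ι)).filter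
        fun T => ∃ E ∈ errorPatterns F g x, Disjoint E T ∧ ⌈300 * (q + t)⌉₊ ≤ E.card).card : ℝ) ≤
      (2 * n).choose n * (Real.exp (-t) / 2) := by
  set m := (min (starNumber F) (n : ℕ∞)).toNat with hm
  set j := ⌈32 * (t + 2)⌉₊ with hj
  set k := ⌈300 * (q + t)⌉₊ with hk
  have hq1 : 1 ≤ q := hq ▸ one_le_tlog _
  obtain ⟨i₀⟩ : Nonempty ι := Fintype.card_pos_iff.1 (by omega)
  have : Nonempty X := ⟨x i₀⟩
  -- Here `a = d = n / 4`. Since `n / 4 ≥ n / 8` after rounding down (for `n ≥ 4`), the exponent is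
  -- at most `m - (32 * m + j) / 32 = -j / 32`, which explains the `32`; `j` then makes it at most
  -- `-(t + 2)`.
  have h := card_avoiding_le (errorPatterns F g x) k n (n / 4) (n / 4) m (32 * m + j)
    (growth F (32 * m + j)) hι (by omega) (by omega)
    (fun W hW => card_essential_le hg x W hW)
    (fun D hD => (card_errorPatterns_subset_le F g x D).trans (growth_mono hD))
  refine h.trans ?_
  refine mul_le_mul_of_nonneg_left ?_ (by positivity)
  have ha : (0 : ℝ) < (n / 4 : ℕ) := by exact_mod_cast (by omega : 0 < n / 4)
  have hn8 : (n : ℝ) ≤ 8 * (n / 4 : ℕ) := by exact_mod_cast (by omega : n ≤ 8 * (n / 4))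
  have hnpos : (0 : ℝ) < n := by exact_mod_cast (by omega : 0 < n)
  have hjge : 32 * (t + 2) ≤ j := Nat.le_ceil _
  have hjle : (j : ℝ) < 32 * (t + 2) + 1 := Nat.ceil_lt_add_one (by linarith)
  have hkge : 300 * (q + t) ≤ k := Nat.le_ceil _
  have hexp2 : Real.exp (-2) ≤ 1 / 4 := by
    have h1 : (2 : ℝ) ≤ Real.exp 1 := by have := Real.add_one_le_exp 1; linarith
    have h2 : (4 : ℝ) ≤ Real.exp 2 := by
      rw [show (2 : ℝ) = 1 + 1 by norm_num, Real.exp_add]; nlinarith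
    rw [Real.exp_neg, ← one_div]
    exact one_div_le_one_div_of_le (by norm_num) h2
  -- Each of the two error terms gets half of the budget `exp (-t) / 2`.
  have hquarter : Real.exp (-t + -2) ≤ Real.exp (-t) / 4 := by
    rw [Real.exp_add]
    have := Real.exp_pos (-t)
    nlinarith
  have hA : Real.exp (m * (n / 4 : ℕ) / (n / 4 : ℕ) -
      (32 * m + j : ℕ) * (n / 4 : ℕ) / (2 * (2 * n)) : ℝ) ≤ Real.exp (-t + -2) := by
    apply Real.exp_le_exp.2
    rw [mul_div_cancel_right₀ _ ha.ne']
    have h1 : ((32 * m + j : ℕ) : ℝ) / 32 ≤ (32 * m + j : ℕ) * (n / 4 : ℕ) / (2 * (2 * n)) := by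
      rw [div_le_div_iff₀ (by norm_num) (by positivity)]
      have : (0 : ℝ) ≤ (32 * m + j : ℕ) := by positivity
      nlinarith
    push_cast at h1 ⊢
    linarith
  -- The exponent is at most `32 * q + j - k / 3` with `j < 32 * t + 65` and `k ≥ 300 * (q + t)`; as
  -- `q, t ≥ 1`, this is below `-t - 2` with room to spare.
  have hB : (growth F (32 * m + j) : ℝ) * (2 / 3 : ℝ) ^ k ≤ Real.exp (-t + -2) := by
    have h1 := growth_mul_add_le_exp (F := F) 32 m j
    have h2 : (2 / 3 : ℝ) ≤ Real.exp (-(1 / 3)) := by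
      have := Real.add_one_le_exp (-(1 / 3) : ℝ); linarith
    have h3 : (2 / 3 : ℝ) ^ k ≤ Real.exp (k * -(1 / 3)) := by
      rw [Real.exp_nat_mul]
      exact pow_le_pow_left₀ (by norm_num) h2 k
    calc _ ≤ Real.exp ((32 : ℕ) * tlog (growth F m) + j) * Real.exp (k * -(1 / 3)) :=
          mul_le_mul h1 h3 (by positivity) (Real.exp_pos _).le
      _ ≤ _ := by
          rw [← Real.exp_add, ← hq]
          apply Real.exp_le_exp.2
          push_cast
          linarith
  linarith

end ERMStar

namespace ERMStar

/-! ### Symmetrization with a ghost sample. -/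

section Sampling

variable {X : Type u}

/-- Some `f ∈ F` agrees with `g` on the points indexed by `T` and disagrees with `g` on at least
`k` of the points. -/
def avoidEvent {ι : Type*} [Fintype ι] (F : Set (X → Label)) (g : X → Label) (k : ℕ)
    (T : Finset ι) : Set (ι → X × Label) :=
  {Z | ∃ f ∈ F, (∀ i ∈ T, f (Z i).1 = g (Z i).1) ∧
    k ≤ (errorPattern g f fun i => (Z i).1).card}

theorem mem_avoidEvent_iff {ι : Type*} [Fintype ι] {F : Set (X → Label)}
    {g : X → Label} {k : ℕ} {T : Finset ι} {Z : ι → X × Label} :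
    Z ∈ avoidEvent F g k T ↔
      ∃ E ∈ errorPatterns F g (fun i => (Z i).1), Disjoint E T ∧ k ≤ E.card := by
  constructor
  · rintro ⟨f, hf, hT, hk⟩
    refine ⟨_, mem_errorPatterns.2 ⟨f, hf, rfl⟩, ?_, hk⟩
    rw [Finset.disjoint_right]
    intro i hi
    rw [mem_errorPattern, not_not]
    exact hT i hi
  · rintro ⟨E, hE, hd, hk⟩
    obtain ⟨f, hf, rfl⟩ := mem_errorPatterns.1 hE
    refine ⟨f, hf, fun i hi => ?_, hk⟩
    have := Finset.disjoint_right.1 hd hi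
    rwa [mem_errorPattern, not_not] at this

theorem IsERM.consistent {F : Set (X → Label)} {n : ℕ}
    {A : (Fin n → X × Label) → (X → Label)} (hA : IsERM F A)
    {g : X → Label} (hgF : g ∈ F) {S : Fin n → X × Label} (hS : ∀ i, (S i).2 = g (S i).1)
    (i : Fin n) : A S (S i).1 = g (S i).1 := by
  have h0 : empRisk S g = 0 := by simp [empRisk, hS]
  have h1 := (hA S).2 g hgF
  rw [h0, empRisk] at h1
  have hn : (0 : ℝ) < n := by exact_mod_cast (Fin.pos i)
  have hnn : ∀ j ∈ Finset.univ, (0 : ℝ) ≤ if A S (S j).1 ≠ (S j).2 then (1 : ℝ) else 0 := by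
    intro j _
    split_ifs <;> norm_num
  have h2 : ∑ j, (if A S (S j).1 ≠ (S j).2 then (1 : ℝ) else 0) ≤ 0 := by
    rw [div_le_iff₀ hn, zero_mul] at h1
    exact h1
  have h3 := (Finset.sum_eq_zero_iff_of_nonneg hnn).1
    (le_antisymm h2 (Finset.sum_nonneg hnn)) i (Finset.mem_univ i)
  by_contra hne
  rw [← hS i] at hne
  rw [if_pos hne] at h3
  norm_num at h3

variable [MeasurableSpace X] {F : Set (X → Label)} {P : Measure (X × Label)}
  [IsProbabilityMeasure P]

theorem measurePreserving_comp_equiv {α β Y : Type*} [Fintype α] [Fintype β] [MeasurableSpace Y]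
    (μ : Measure Y) [SigmaFinite μ] (e : α ≃ β) :
    MeasurePreserving (fun (Z : β → Y) (j : α) => Z (e j))
      (Measure.pi fun _ => μ) (Measure.pi fun _ => μ) := by
  have := measurePreserving_piCongrLeft (fun _ : α => μ) e.symm
  convert this using 1
  funext Z j
  obtain ⟨b, rfl⟩ := e.symm.surjective j
  rw [MeasurableEquiv.coe_piCongrLeft, Equiv.piCongrLeft_apply_apply, Equiv.apply_symm_apply]

theorem nullMeasurableSet_realized {ι : Type*} [Fintype ι] (hP : MeasurableProjections P F)
    (y : ι → Label) :
    NullMeasurableSet {Z : ι → X × Label | ∃ f ∈ F, ∀ i, f (Z i).1 = y i}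
      (Measure.pi fun _ => P) := by
  let e := (Fintype.equivFin ι).symm
  have : IsProbabilityMeasure (P.map Prod.fst) :=
    Measure.isProbabilityMeasure_map measurable_fst.aemeasurable
  have h1 := measurePreserving_comp_equiv (P.map Prod.fst) e
  have h2 : MeasurePreserving (fun (Z : ι → X × Label) i => (Z i).1)
      (Measure.pi fun _ => P) (Measure.pi fun _ => P.map Prod.fst) :=
    measurePreserving_pi (fun _ => P) (fun _ => P.map Prod.fst)
      (fun _ => measurable_fst.measurePreserving P)
  have h3 := (hP _ fun j => y (e j)).preimage (h1.comp h2).quasiMeasurePreserving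
  convert h3 using 1
  ext Z
  simp only [projection, Set.mem_preimage, Set.mem_ofPred_eq, Set.mem_image, Function.comp]
  refine exists_congr fun f => and_congr_right fun _ => ?_
  rw [funext_iff]
  exact (e.forall_congr_right (q := fun i => f (Z i).1 = y i)).symm

/-- `F` may be uncountable, but the event depends on `f` only through its labels on finitely many
points, so it is a finite union over labellings. -/
theorem nullMeasurableSet_avoidEvent {ι : Type*} [Fintype ι] (hP : MeasurableProjections P F)
    {g : X → Label} (hg : Measurable g) (k : ℕ) (T : Finset ι) :
    NullMeasurableSet (avoidEvent F g k T) (Measure.pi fun _ => P) := by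
  have heq : avoidEvent F g k T = ⋃ y : ι → Label,
      {Z : ι → X × Label | ∃ f ∈ F, ∀ i, f (Z i).1 = y i} ∩
      (fun Z i => g (Z i).1) ⁻¹' {v : ι → Label | (∀ i ∈ T, y i = v i) ∧
        k ≤ (Finset.univ.filter fun i => y i ≠ v i).card} := by
    ext Z
    simp only [avoidEvent, errorPattern, Set.mem_ofPred_eq, Set.mem_iUnion, Set.mem_inter_iff,
      Set.mem_preimage]
    constructor
    · rintro ⟨f, hf, h1, h2⟩
      exact ⟨fun i => f (Z i).1, ⟨f, hf, fun _ => rfl⟩, h1, h2⟩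
    · rintro ⟨y, ⟨f, hf, hy⟩, h1, h2⟩
      obtain rfl : (fun i => f (Z i).1) = y := funext hy
      exact ⟨f, hf, h1, h2⟩
  rw [heq]
  refine NullMeasurableSet.iUnion fun y => (nullMeasurableSet_realized hP y).inter ?_
  have hm : Measurable fun (Z : ι → X × Label) i => g (Z i).1 := by fun_prop
  exact (hm (MeasurableSet.of_discrete)).nullMeasurableSet

/-- Exchangeability: a permutation of the indices carrying `T` to `T'` preserves the product law. -/
theorem measure_avoidEvent_eq {ι : Type*} [Fintype ι] [DecidableEq ι]
    (hP : MeasurableProjections P F)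
    {g : X → Label} (hg : Measurable g) (k : ℕ) {T T' : Finset ι} (h : T.card = T'.card) :
    Measure.pi (fun _ : ι => P) (avoidEvent F g k T) =
      Measure.pi (fun _ : ι => P) (avoidEvent F g k T') := by
  have e : {i // i ∈ T} ≃ {i // i ∈ T'} := Finset.equivOfCardEq h
  let σ : Equiv.Perm ι := e.extendSubtype
  have hσ : ∀ i, σ i ∈ T' ↔ i ∈ T := fun i =>
    ⟨fun hi => by
      by_contra hn
      exact e.extendSubtype_not_mem i hn hi, fun hi => e.extendSubtype_mem i hi⟩
  have hmp := measurePreserving_comp_equiv P σ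
  rw [← hmp.measure_preimage (nullMeasurableSet_avoidEvent hP hg k T)]
  congr 1
  ext Z
  simp only [avoidEvent, Set.mem_preimage, Set.mem_ofPred_eq]
  refine exists_congr fun f => and_congr_right fun _ => and_congr ?_ ?_
  · constructor
    · intro h i hi
      obtain ⟨j, rfl⟩ := σ.surjective i
      exact h j ((hσ j).1 hi)
    · exact fun h i hi => h (σ i) ((hσ i).2 hi)
  · have : (errorPattern g f fun i => (Z (σ i)).1).map σ.toEmbedding =
        errorPattern g f fun i => (Z i).1 := by
      ext i
      obtain ⟨j, rfl⟩ := σ.surjective i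
      simp [mem_errorPattern]
    rw [← this, Finset.card_map]

/-- The probability is the same for every `n`-subset, hence equals its average over all of them, and
that average is bounded pointwise in the `2 * n` points by `card_consistent_le`. -/
theorem measure_avoidEvent_le {ι : Type*} [Fintype ι] [DecidableEq ι]
    (hP : MeasurableProjections P F) {g : X → Label} (hg : Measurable g) (hgF : g ∈ F) {n : ℕ}
    (hn : 4 ≤ n) (hι : Fintype.card ι = 2 * n) {q t : ℝ}
    (hq : q = tlog (growth F (min (starNumber F) (n : ℕ∞)).toNat)) (ht : 1 ≤ t)
    (T₀ : Finset ι) (hT₀ : T₀.card = n) :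
    Measure.pi (fun _ : ι => P) (avoidEvent F g ⌈300 * (q + t)⌉₊ T₀) ≤
      ENNReal.ofReal (Real.exp (-t) / 2) := by
  classical
  set k := ⌈300 * (q + t)⌉₊ with hk
  set μ := Measure.pi (fun _ : ι => P) with hμ
  have hsum : ∑ T ∈ Finset.powersetCard n (Finset.univ : Finset ι), μ (avoidEvent F g k T) =
      ((2 * n).choose n : ℕ) * μ (avoidEvent F g k T₀) := by
    rw [Finset.sum_congr rfl fun T hT => measure_avoidEvent_eq hP hg k
      ((Finset.mem_powersetCard.1 hT).2.trans hT₀.symm), Finset.sum_const,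
      Finset.card_powersetCard, Finset.card_univ, hι, nsmul_eq_mul]
  have hle : ∑ T ∈ Finset.powersetCard n (Finset.univ : Finset ι), μ (avoidEvent F g k T) ≤
      ((2 * n).choose n : ℕ) * ENNReal.ofReal (Real.exp (-t) / 2) := by
    have hnull := fun T : Finset ι => nullMeasurableSet_avoidEvent hP hg k T
    calc _ = ∑ T ∈ Finset.powersetCard n (Finset.univ : Finset ι),
          ∫⁻ Z, (avoidEvent F g k T).indicator 1 Z ∂μ :=
          Finset.sum_congr rfl fun T _ => (lintegral_indicator_one₀ (hnull T)).symm
      _ = ∫⁻ Z, ∑ T ∈ Finset.powersetCard n (Finset.univ : Finset ι),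
          (avoidEvent F g k T).indicator 1 Z ∂μ :=
          (lintegral_finsetSum' _ fun T _ => aemeasurable_one.indicator₀ (hnull T)).symm
      _ ≤ ∫⁻ _, ((2 * n).choose n : ℕ) * ENNReal.ofReal (Real.exp (-t) / 2) ∂μ := by
          refine lintegral_mono fun Z => ?_
          have h := card_consistent_le hgF (fun i => (Z i).1) hn hι hq ht
          simp only [Set.indicator_apply, Pi.one_apply, Finset.sum_boole, mem_avoidEvent_iff]
          rw [← ENNReal.ofReal_natCast, ← ENNReal.ofReal_natCast,
            ← ENNReal.ofReal_mul (by positivity)]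
          exact ENNReal.ofReal_le_ofReal h
      _ = _ := by simp
  rw [hsum] at hle
  refine (ENNReal.mul_le_mul_iff_right ?_ (ENNReal.natCast_ne_top _)).1 hle
  exact_mod_cast (Nat.choose_pos (by omega)).ne'

/-- A Chernoff bound through the mean of `2 ^ (-count)`, which is `(1 - p / 2) ^ n`, so that only
products of independent factors are integrated. -/
theorem half_le_measure_count {Y : Type*} [MeasurableSpace Y] (μ : Measure Y)
    [IsProbabilityMeasure μ] {D : Set Y} (hD : MeasurableSet D) (n : ℕ)
    (h : 10 ≤ n * μ.real D) [DecidablePred (· ∈ D)] :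
    1 / 2 ≤ (Measure.pi fun _ : Fin n => μ).real
      {S | n * μ.real D / 2 ≤ ((Finset.univ.filter fun i => S i ∈ D).card : ℝ)} := by
  set p := μ.real D with hp
  set ν := Measure.pi fun _ : Fin n => μ with hν
  have hcount : Measurable fun S : Fin n → Y =>
      ((Finset.univ.filter fun i => S i ∈ D).card : ℝ) := by
    have : (fun S : Fin n → Y => ((Finset.univ.filter fun i => S i ∈ D).card : ℝ)) =
        fun S => ∑ i, D.indicator (fun _ => (1 : ℝ)) (S i) := by
      funext S
      simp [Set.indicator_apply]
    rw [this]
    exact Finset.measurable_sum _ fun i _ =>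
      (measurable_const.indicator hD).comp (measurable_pi_apply i)
  let φ : Y → ℝ := fun z => 1 - D.indicator (fun _ => (1 : ℝ)) z / 2
  have hφm : Measurable φ := measurable_const.sub ((measurable_const.indicator hD).div_const 2)
  have hφ : ∀ z, φ z = if z ∈ D then 1 / 2 else 1 := by
    intro z
    simp only [φ, Set.indicator_apply]
    split_ifs <;> norm_num
  have hφint : ∫ z, φ z ∂μ = 1 - p / 2 := by
    rw [integral_sub (integrable_const _)
      (((integrable_const (1 : ℝ)).indicator hD).div_const 2), integral_div,
      integral_indicator_const _ hD]
    simp [hp]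
  have hprod : ∫ S, ∏ i, φ (S i) ∂ν = (1 - p / 2) ^ n := by
    rw [hν, integral_fintype_prod_eq_prod (fun _ : Fin n => φ)]
    simp [hφint]
  have hprodval : ∀ S : Fin n → Y,
      ∏ i, φ (S i) = (1 / 2 : ℝ) ^ (Finset.univ.filter fun i => S i ∈ D).card := by
    intro S
    simp only [hφ]
    rw [Finset.prod_ite]
    simp
  have hprod01 : ∀ S : Fin n → Y, 0 ≤ ∏ i, φ (S i) ∧ ∏ i, φ (S i) ≤ 1 := by
    intro S
    rw [hprodval]
    exact ⟨by positivity, pow_le_one₀ (by norm_num) (by norm_num)⟩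
  have hint : Integrable (fun S => ∏ i, φ (S i)) ν := by
    refine Integrable.of_bound (C := 1) ?_ (Filter.Eventually.of_forall fun S => ?_)
    · exact (Finset.measurable_prod _ fun i _ =>
        hφm.comp (measurable_pi_apply i)).aestronglyMeasurable
    · rw [Real.norm_of_nonneg (hprod01 S).1]
      exact (hprod01 S).2
  have hmarkov := mul_meas_ge_le_integral_of_nonneg
    (Filter.Eventually.of_forall fun S => (hprod01 S).1) hint
    (Real.exp (-(Real.log 2 * (n * p / 2))))
  have hset : MeasurableSet
      {S : Fin n → Y | n * p / 2 ≤ ((Finset.univ.filter fun i => S i ∈ D).card : ℝ)} :=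
    measurableSet_le measurable_const hcount
  have hsub : {S : Fin n → Y | n * p / 2 ≤ ((Finset.univ.filter fun i => S i ∈ D).card : ℝ)}ᶜ ⊆
      {S | Real.exp (-(Real.log 2 * (n * p / 2))) ≤ ∏ i, φ (S i)} := by
    intro S hS
    simp only [Set.mem_compl_iff, Set.mem_ofPred_eq, not_le] at hS ⊢
    rw [hprodval, one_div, inv_pow, ← Real.exp_log (show (0 : ℝ) < 2 by norm_num),
      ← Real.exp_nat_mul, ← Real.exp_neg, Real.exp_log (show (0 : ℝ) < 2 by norm_num)]
    apply Real.exp_le_exp.2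
    have := Real.log_pos (show (1 : ℝ) < 2 by norm_num)
    nlinarith
  have hcompl := measureReal_mono (μ := ν) hsub
  have hpow : (1 - p / 2) ^ n ≤ Real.exp (-(n * p / 2)) := by
    have h1 : 1 - p / 2 ≤ Real.exp (-(p / 2)) := by
      have := Real.add_one_le_exp (-(p / 2)); linarith
    have hp1 : p ≤ 1 := measureReal_le_one
    calc (1 - p / 2) ^ n ≤ Real.exp (-(p / 2)) ^ n := pow_le_pow_left₀ (by linarith) h1 n
      _ = _ := by rw [← Real.exp_nat_mul]; congr 1; ring
  rw [hprod] at hmarkov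
  -- This amounts to `(1 - log 2) * (n * p / 2) ≥ log 2`, where `n * p / 2 ≥ 5`.
  have hfin : Real.exp (-(n * p / 2)) ≤ Real.exp (-(Real.log 2 * (n * p / 2))) * (1 / 2) := by
    have h2 : Real.exp (-Real.log 2) = 1 / 2 := by
      rw [Real.exp_neg, Real.exp_log (by norm_num), one_div]
    rw [← h2, ← Real.exp_add]
    apply Real.exp_le_exp.2
    have := Real.log_two_lt_d9
    nlinarith
  have hhalf : ν.real {S | Real.exp (-(Real.log 2 * (n * p / 2))) ≤ ∏ i, φ (S i)} ≤ 1 / 2 :=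
    le_of_mul_le_mul_left (hmarkov.trans (hpow.trans hfin)) (Real.exp_pos _)
  rw [probReal_compl_eq_one_sub hset] at hcompl
  linarith

theorem ae_forall_label {ι : Type*} [Fintype ι] {g : X → Label} (h : ∀ᵐ z ∂P, z.2 = g z.1) :
    ∀ᵐ S ∂(Measure.pi fun _ : ι => P), ∀ i, (S i).2 = g (S i).1 :=
  ae_all_iff.2 fun i => (Measure.tendsto_eval_ae_ae (μ := fun _ : ι => P) (i := i)).eventually h

/-- Deviation bound for empirical risk minimizers in the realizable case. -/
theorem measure_risk_gt_le (hF : ∀ f ∈ F, Measurable f) (hR : Realizable P F)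
    (hP : MeasurableProjections P F) {n : ℕ} (hn : 1 ≤ n)
    {A : (Fin n → X × Label) → (X → Label)} (hA : IsERM F A)
    (hm : AEMeasurable (fun S => risk P (A S)) (sampleLaw P n)) {q t : ℝ}
    (hq : q = tlog (growth F (min (starNumber F) (n : ℕ∞)).toNat)) (ht : 1 ≤ t) :
    (sampleLaw P n).real {S | 600 * (q + t) / n < risk P (A S)} ≤ Real.exp (-t) := by
  classical
  obtain ⟨g, hgF, hg⟩ := hR
  have hq1 : 1 ≤ q := hq ▸ one_le_tlog _
  have hnpos : (0 : ℝ) < n := by exact_mod_cast hn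
  rcases lt_or_ge n 4 with hn4 | hn4
  · have hempty : {S | 600 * (q + t) / n < risk P (A S)} = ∅ := by
      refine Set.eq_empty_of_forall_notMem fun S hS => ?_
      have h1 : risk P (A S) ≤ 1 := measureReal_le_one
      have h2 : (n : ℝ) < 4 := by exact_mod_cast hn4
      have h3 := lt_of_lt_of_le (Set.mem_ofPred_eq.mp hS) h1
      rw [div_lt_one hnpos] at h3
      linarith
    rw [hempty, measureReal_empty]
    exact (Real.exp_pos _).le
  set k := ⌈300 * (q + t)⌉₊ with hk
  set ν := sampleLaw P n with hν
  have hprobν : IsProbabilityMeasure ν := by rw [hν, sampleLaw]; infer_instance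
  set U := {S | 600 * (q + t) / n < risk P (A S)} with hU
  have hUm : NullMeasurableSet U ν := nullMeasurableSet_lt aemeasurable_const hm
  let T₀ : Finset (Fin n ⊕ Fin n) := Finset.univ.map Function.Embedding.inl
  have hT₀ : T₀.card = n := by simp [T₀]
  have hB := measure_avoidEvent_le (ι := Fin n ⊕ Fin n) hP (hF g hgF) hgF hn4
    (by simp [two_mul]) hq ht T₀ hT₀
  rw [← measure_toMeasurable] at hB
  -- The event is only null measurable; its measurable hull has the same measure and lets Tonelli's
  -- theorem apply to the sample (`Sum.inl`) and the ghost sample (`Sum.inr`).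
  set B := toMeasurable (Measure.pi fun _ : Fin n ⊕ Fin n => P) (avoidEvent F g k T₀) with hBdef
  have hBm : MeasurableSet B := measurableSet_toMeasurable _ _
  have hmp := measurePreserving_sumPiEquivProdPi_symm
    (X := fun _ : Fin n ⊕ Fin n => X × Label) (fun _ => P)
  rw [← hmp.measure_preimage hBm.nullMeasurableSet, Measure.prod_apply (hmp.measurable hBm)] at hB
  -- For almost every sample in `U`, the ghost sample puts the pair into the avoiding event with
  -- probability at least `1/2`; hence half the probability of `U` is at most `exp (-t) / 2`.
  have hlow : ∫⁻ S, U.indicator (fun _ => (1 / 2 : ENNReal)) S ∂ν ≤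
      ENNReal.ofReal (Real.exp (-t) / 2) := by
    refine le_trans (lintegral_mono_ae ?_) hB
    filter_upwards [ae_forall_label (ι := Fin n) hg] with S hS
    by_cases hSU : S ∈ U
    · rw [Set.indicator_of_mem hSU]
      have hfm := hF _ (hA S).1
      have hD : MeasurableSet {z : X × Label | A S z.1 ≠ z.2} :=
        (measurableSet_eq_fun (hfm.comp measurable_fst) measurable_snd).compl
      have hrisk : 600 * (q + t) < n * P.real {z : X × Label | A S z.1 ≠ z.2} := by
        have : 600 * (q + t) / n < P.real {z : X × Label | A S z.1 ≠ z.2} := hSU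
        rwa [div_lt_iff₀' hnpos] at this
      have hhalf := half_le_measure_count P hD n (by linarith)
      rw [Measure.real, ← ENNReal.ofReal_le_iff_le_toReal (measure_ne_top _ _)] at hhalf
      refine le_trans (le_of_eq ?_) (hhalf.trans ?_)
      · rw [ENNReal.ofReal_div_of_pos (by norm_num)]; simp
      · refine measure_mono_ae ?_
        filter_upwards [ae_forall_label (ι := Fin n) hg] with S' hS' hcount
        refine subset_toMeasurable _ _ ?_
        refine ⟨A S, (hA S).1, ?_, ?_⟩
        · intro i hi
          obtain ⟨i, -, rfl⟩ := Finset.mem_map.1 hi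
          exact hA.consistent hgF hS i
        · rw [hk, Nat.ceil_le]
          have h1 : 300 * (q + t) ≤
              ((Finset.univ.filter fun i => S' i ∈ {z : X × Label | A S z.1 ≠ z.2}).card : ℝ) := by
            have : n * P.real {z : X × Label | A S z.1 ≠ z.2} / 2 ≤
              ((Finset.univ.filter fun i => S' i ∈ {z : X × Label | A S z.1 ≠ z.2}).card : ℝ) :=
              hcount
            linarith
          refine h1.trans ?_
          rw [Nat.cast_le]
          refine Finset.card_le_card_of_injOn Sum.inr ?_ Sum.inr_injective.injOn
          intro i hi
          simp only [Finset.coe_filter, Finset.mem_univ, true_and, Set.mem_ofPred_eq] at hi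
          rw [Finset.mem_coe, mem_errorPattern]
          rw [hS' i] at hi
          exact hi
    · rw [Set.indicator_of_notMem hSU]
      exact zero_le
  rw [lintegral_indicator₀ hUm, setLIntegral_const] at hlow
  have h2 : ν U ≤ ENNReal.ofReal (Real.exp (-t)) := by
    have h3 := mul_le_mul_right hlow (2 : ENNReal)
    rw [← mul_assoc, one_div, ENNReal.mul_inv_cancel (by norm_num) (by norm_num), one_mul] at h3
    refine h3.trans (le_of_eq ?_)
    rw [← ENNReal.ofReal_ofNat, ← ENNReal.ofReal_mul (by norm_num)]
    congr 1
    ring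
  exact ENNReal.toReal_le_of_le_ofReal (Real.exp_pos _).le h2

end Sampling

end ERMStar

/-! ### From exponential tails to the mean. -/

namespace ERMStar

theorem sum_exp_neg_le_one (n : ℕ) :
    ∑ j ∈ Finset.range n, Real.exp (-((j : ℝ) + 1)) ≤ 1 := by
  have h : ∀ j : ℕ, Real.exp (-((j : ℝ) + 1)) ≤ (1 / 2 : ℝ) ^ (j + 1) := by
    intro j
    have h1 : Real.exp (-1) ≤ 1 / 2 := by
      rw [Real.exp_neg, ← one_div]
      exact one_div_le_one_div_of_le (by norm_num) (by
        have := Real.add_one_le_exp 1; linarith)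
    have h2 : Real.exp (-((j : ℝ) + 1)) = Real.exp (-1) ^ (j + 1) := by
      rw [← Real.exp_nat_mul]; congr 1; push_cast; ring
    rw [h2]
    exact pow_le_pow_left₀ (Real.exp_pos _).le h1 _
  have hs : ∀ n : ℕ, ∑ j ∈ Finset.range n, (1 / 2 : ℝ) ^ (j + 1) = 1 - (1 / 2) ^ n := by
    intro n
    induction n with
    | zero => simp
    | succ n ih => rw [Finset.sum_range_succ, ih]; ring
  refine (Finset.sum_le_sum fun j _ => h j).trans ?_
  rw [hs]
  have : (0 : ℝ) ≤ (1 / 2) ^ n := by positivity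
  linarith

theorem le_one_add_card_filter_lt {y : ℝ} {n : ℕ} (hy : y ≤ n) :
    y ≤ 1 + ((Finset.range n).filter fun j : ℕ => (j : ℝ) + 1 < y).card := by
  have hsub : Finset.range (⌈y⌉₊ - 1) ⊆
      (Finset.range n).filter fun j : ℕ => (j : ℝ) + 1 < y := by
    intro j hj
    rw [Finset.mem_range] at hj
    have h1 : j + 1 < ⌈y⌉₊ := by omega
    have h2 : ⌈y⌉₊ ≤ n := Nat.ceil_le.2 hy
    have h3 := Nat.lt_ceil.1 h1
    push_cast at h3
    exact Finset.mem_filter.2 ⟨Finset.mem_range.2 (by omega), h3⟩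
  have h := Finset.card_le_card hsub
  rw [Finset.card_range] at h
  have h2 : ⌈y⌉₊ ≤ 1 + ((Finset.range n).filter fun j : ℕ => (j : ℝ) + 1 < y).card := by omega
  exact (Nat.le_ceil y).trans (by exact_mod_cast h2)

/-- A variable in `[0, 1]` whose tail beyond `c * (q + t) / n` is at most `exp (-t)` for `t ≥ 1` has
mean at most `c * (q + 2) / n`. -/
theorem integral_le_of_exp_tail {Ω : Type*} [MeasurableSpace Ω] {ν : Measure Ω}
    [IsProbabilityMeasure ν] {R : Ω → ℝ} (hR : AEMeasurable R ν) (hR0 : ∀ ω, 0 ≤ R ω)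
    (hR1 : ∀ ω, R ω ≤ 1) {c q : ℝ} (hc : 1 ≤ c) (hq : 0 ≤ q) {n : ℕ} (hn : 1 ≤ n)
    (htail : ∀ t : ℝ, 1 ≤ t → ν.real {ω | c * (q + t) / n < R ω} ≤ Real.exp (-t)) :
    Integrable R ν ∧ ∫ ω, R ω ∂ν ≤ c * (q + 2) / n := by
  have hnpos : (0 : ℝ) < n := by exact_mod_cast hn
  have hcpos : 0 < c := by linarith
  have hint : Integrable R ν := by
    refine Integrable.of_bound (C := 1) hR.aestronglyMeasurable
      (Filter.Eventually.of_forall fun ω => ?_)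
    rw [Real.norm_of_nonneg (hR0 ω)]
    exact hR1 ω
  refine ⟨hint, ?_⟩
  let U : ℕ → Set Ω := fun j => {ω | c * (q + ((j : ℝ) + 1)) / n < R ω}
  have hU : ∀ j, NullMeasurableSet (U j) ν := fun j => nullMeasurableSet_lt aemeasurable_const hR
  have hUint : ∀ j, Integrable ((U j).indicator fun _ => (1 : ℝ)) ν := fun j =>
    (integrable_const (1 : ℝ)).indicator₀ (hU j)
  -- A discrete layer-cake bound at the levels `t = 1, ..., n`; these suffice because `R ≤ 1 ≤ c`
  -- gives `n * R / c - q ≤ n`.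
  have hpt : ∀ ω, R ω ≤ c / n * (q + 1 +
      ∑ j ∈ Finset.range n, (U j).indicator (fun _ => (1 : ℝ)) ω) := by
    intro ω
    classical
    have hy : n * R ω / c - q ≤ n := by
      have : n * R ω / c ≤ n := by
        rw [div_le_iff₀ hcpos]
        nlinarith [hR1 ω]
      linarith
    have h := le_one_add_card_filter_lt hy
    have hcard : ∑ j ∈ Finset.range n, (U j).indicator (fun _ => (1 : ℝ)) ω =
        ((Finset.range n).filter fun j : ℕ => (j : ℝ) + 1 < n * R ω / c - q).card := by
      simp only [Set.indicator_apply, Finset.sum_boole]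
      congr 2
      refine Finset.filter_congr fun j _ => ?_
      simp only [U, Set.mem_ofPred_eq]
      rw [div_lt_iff₀ hnpos, lt_sub_iff_add_lt, lt_div_iff₀ hcpos]
      constructor <;> intro h <;> linarith
    rw [hcard, div_mul_eq_mul_div, le_div_iff₀ hnpos]
    have h2 : n * R ω / c ≤ q + 1 +
      ((Finset.range n).filter fun j : ℕ => (j : ℝ) + 1 < n * R ω / c - q).card := by linarith
    rw [div_le_iff₀ hcpos] at h2
    linarith
  have hsumint : Integrable (fun ω =>
      ∑ j ∈ Finset.range n, (U j).indicator (fun _ => (1 : ℝ)) ω) ν :=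
    integrable_finsetSum _ fun j _ => hUint j
  have hle := integral_mono hint (((integrable_const (q + 1)).add hsumint).const_mul (c / n))
    fun ω => hpt ω
  refine hle.trans ?_
  have hval : ∫ ω, c / n * (q + 1 +
      ∑ j ∈ Finset.range n, (U j).indicator (fun _ => (1 : ℝ)) ω) ∂ν =
      c / n * (q + 1 + ∑ j ∈ Finset.range n, ν.real (U j)) := by
    rw [integral_const_mul, integral_add (integrable_const _) hsumint,
      integral_finsetSum _ fun j _ => hUint j]
    congr 2
    · simp
    · refine Finset.sum_congr rfl fun j _ => ?_
      rw [integral_indicator₀ (hU j)]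
      simp
  have hsum : ∑ j ∈ Finset.range n, ν.real (U j) ≤ 1 :=
    (Finset.sum_le_sum fun j _ => htail _ (by
      have : (0 : ℝ) ≤ j := by positivity
      linarith)).trans (sum_exp_neg_le_one n)
  calc _ = c / n * (q + 1 + ∑ j ∈ Finset.range n, ν.real (U j)) := hval
    _ ≤ c / n * (q + 2) := mul_le_mul_of_nonneg_left (by linarith) (by positivity)
    _ = _ := by ring

end ERMStar

/-! ### The theorem. -/

open ERMStar
theorem theorem3p1 :
    ∃ C : ℝ, 0 < C ∧
      ∀ (X : Type u) [MeasurableSpace X] (F : Set (X → Label)) (_ : ∀ f ∈ F, Measurable f)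
        (P : Measure (X × Label)) [IsProbabilityMeasure P]
        (_ : Realizable P F) (_ : MeasurableProjections P F)
        (n : ℕ) (_ : 1 ≤ n)
        (fhat : (Fin n → X × Label) → (X → Label)) (_ : IsERM F fhat)
        (_ : AEMeasurable (fun S => risk P (fhat S)) (sampleLaw P n)),
        (Integrable (fun S => risk P (fhat S)) (sampleLaw P n) ∧
          ∫ S, risk P (fhat S) ∂(sampleLaw P n)
            ≤ C * (tlog (growth F (min (starNumber F) (n : ℕ∞)).toNat) / n)) ∧
        ∀ δ : ℝ, 0 < δ → δ < 1 →
          1 - δ ≤ (sampleLaw P n).real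
            {S | risk P (fhat S)
              ≤ C * (tlog (growth F (min (starNumber F) (n : ℕ∞)).toNat) / n
                    + tlog (1 / δ) / n)} := by
  -- As `q ≥ 1`, the mean bound `600 * (q + 2) / n` is at most `1800 * q / n`; the tail bound needs
  -- only `600`.
  refine ⟨1800, by norm_num, ?_⟩
  intro X _ F hF P _ hR hP n hn fhat hA hm
  set q := tlog (growth F (min (starNumber F) (n : ℕ∞)).toNat) with hq
  have hq1 : 1 ≤ q := one_le_tlog _
  have hnpos : (0 : ℝ) < n := by exact_mod_cast hn
  have hprob : IsProbabilityMeasure (sampleLaw P n) := by rw [sampleLaw]; infer_instance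
  have htail : ∀ t : ℝ, 1 ≤ t →
      (sampleLaw P n).real {S | 600 * (q + t) / n < risk P (fhat S)} ≤ Real.exp (-t) :=
    fun t ht => measure_risk_gt_le hF hR hP hn hA hm hq ht
  refine ⟨?_, fun δ hδ _ => ?_⟩
  · have h := integral_le_of_exp_tail hm (fun S => measureReal_nonneg)
      (fun S => measureReal_le_one) (by norm_num) (by linarith) hn htail
    refine ⟨h.1, h.2.trans ?_⟩
    rw [← mul_div_assoc]
    exact div_le_div_of_nonneg_right (by linarith) hnpos.le
  -- The truncation supplies `t ≥ 1`, as the tail bound requires, and keeps `exp (-t) ≤ δ`.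
  · set t := tlog (1 / δ) with ht
    have ht1 : 1 ≤ t := one_le_tlog _
    have hexp : Real.exp (-t) ≤ δ := by
      have := le_exp_tlog (1 / δ)
      rw [Real.exp_neg, inv_le_comm₀ (Real.exp_pos _) hδ, ← one_div]
      exact this
    set V := {S | risk P (fhat S) ≤ 1800 * (q / n + t / n)} with hV
    have hsub : Vᶜ ⊆ {S | 600 * (q + t) / n < risk P (fhat S)} := by
      intro S hS
      simp only [hV, Set.mem_compl_iff, Set.mem_ofPred_eq, not_le] at hS ⊢
      refine lt_of_le_of_lt ?_ hS
      rw [← add_div, ← mul_div_assoc]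
      gcongr
      norm_num
    have h1 := (measureReal_mono (μ := sampleLaw P n) hsub).trans ((htail t ht1).trans hexp)
    -- Subadditivity over `V` and its complement gives the lower bound without measurability of `V`.
    have h2 := measureReal_union_le (μ := sampleLaw P n) V Vᶜ
    rw [Set.union_compl_self, probReal_univ] at h2
    linarith
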